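/- Let $\mathbb F$ be a field of characteristic $0$, let $n\ge 2$, and let $\ell_1,\ell_2\in\mathbb N=\{0,1,2,\dots\}$. Let $sl(n,\mathbb F)$ act on $\mathbb F[x_1,\dots,x_n,y_1,\dots,y_n]$ by the linear extension of $E_{i,j}\mapsto x_i\partial_{x_j}-y_j\partial_{y_i}$. Let $H=\sum_{i=1}^{n-1}\mathbb F(E_{i,i}-E_{i+1,i+1})$, with fundamental weights $\lambda_1,\dots,\lambda_{n-1}\in H^*$ given by $\lambda_i(E_{j,j}-E_{j+1,j+1})=\delta_{i,j}$, and take $E_{i,j}$ $(i<j)$ as positive root vectors. Let $V_{\ell_1,\ell_2}$ be the $sl(n,\mathbb F)$-submodule generated by $x_1^{\ell_1}y_n^{\ell_2}$. Then: (1) $V_{\ell_1,\ell_2}$ is an irreducible highest weight module with highest weight $\ell_1\lambda_1+\ell_2\lambda_{n-1}$, and $x_1^{\ell_1}y_n^{\ell_2}$ is a highest weight vector: it is nonzero, has this weight, and is killed by all $E_{i,j}$ with $i<j$. (2) $V_{\ell_1,\ell_2}$ is the set of all polynomials $f$, homogeneous of degree $\ell_1$ in $x_1,\dots,x_n$ and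 homogeneous of degree $\ell_2$ in $y_1,\dots,y_n$, such that $\sum_{i=1}^n\partial_{x_i}\partial_{y_i}(f)=0$. (3) Write $|i|=i_2+\cdots+i_n$. The set consisting of the polynomials $$\sum_{i_2,\dots,i_n=0}^{\infty}\frac{(-1)^{|i|}\prod_{r=2}^n\binom{m_r}{i_r}\binom{l_r}{i_r}}{\binom{m+|i|}{m}\binom{|i|}{i_2,\dots,i_n}}\,x_1^{m+|i|}y_1^{|i|}\prod_{r=2}^n x_r^{m_r-i_r}y_r^{l_r-i_r}$$ for all $m,m_r,l_r\in\mathbb N$ with $m+\sum_{r=2}^n m_r=\ell_1$ and $\sum_{r=2}^n l_r=\ell_2$, together with the polynomials $$\sum_{i_2,\dots,i_n=0}^{\infty}\frac{(-1)^{|i|}\prod_{r=2}^n\binom{m'_r}{i_r}\binom{l'_r}{i_r}}{\binom{m'+|i|}{m'}\binom{|i|}{i_2,\dots,i_n}}\,x_1^{|i|}y_1^{m'+|i|}\prod_{r=2}^n x_r^{m'_r-i_r}y_r^{l'_r-i_r}$$ for all $m',m'_r,l'_r\in\mathbb N$ with $\sum_{r=2}^n m'_r=\ell_1$ and $m'+\sum_{r=2}^n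 l'_r=\ell_2$, is a basis of $V_{\ell_1,\ell_2}$. (The sums are finite, since the binomial coefficients vanish unless $i_r\le m_r$ and $i_r\le l_r$, respectively $i_r\le m'_r$ and $i_r\le l'_r$, for all $r$.) -/

import Mathlib

open MvPolynomial LieAlgebra.SpecialLinear

attribute [local instance 100] LieRing.ofAssociativeRing

noncomputable section

namespace SlPoly

/-- The polynomial algebra `F[x₁,…,xₙ,y₁,…,yₙ]`; the indices `1,…,n` are the elements
`0,…,n-1` of `Fin n`. -/
abbrev Poly (n : ℕ) (F : Type*) [Field F] : Type _ := MvPolynomial (Fin n ⊕ Fin n) F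

section Action

variable {n : ℕ} {F : Type*} [Field F]

/-- The variable `x_i`. -/
abbrev x (i : Fin n) : Poly n F := X (Sum.inl i)

/-- The variable `y_i`. -/
abbrev y (i : Fin n) : Poly n F := X (Sum.inr i)

/-- The derivation `∂/∂x_i`. -/
abbrev dx (i : Fin n) : Derivation F (Poly n F) (Poly n F) := pderiv (Sum.inl i)

/-- The derivation `∂/∂y_i`. -/
abbrev dy (i : Fin n) : Derivation F (Poly n F) (Poly n F) := pderiv (Sum.inr i)

/-- The operator `x_i ∂_{x_j} - y_j ∂_{y_i}`, by which `E_{i,j}` acts. -/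
def opE (i j : Fin n) : Derivation F (Poly n F) (Poly n F) :=
  (x i : Poly n F) • dx j - (y j : Poly n F) • dy i

/-- The linear extension of `E_{i,j} ↦ x_i ∂_{x_j} - y_j ∂_{y_i}` to all matrices. -/
def act (A : Matrix (Fin n) (Fin n) F) : Derivation F (Poly n F) (Poly n F) :=
  ∑ i, ∑ j, A i j • opE i j

theorem act_apply (A : Matrix (Fin n) (Fin n) F) (p : Poly n F) :
    act A p = ∑ i, ∑ j, A i j • (x i * dx j p - y j * dy i p) := by
  simp only [act, opE]
  rw [← Derivation.coeFnAddMonoidHom_apply]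
  simp only [map_sum, Finset.sum_apply]
  rfl

theorem act_x (A : Matrix (Fin n) (Fin n) F) (k : Fin n) :
    act A (x k) = ∑ i, A i k • (x i : Poly n F) := by
  rw [act_apply]
  refine Finset.sum_congr rfl fun i _ => ?_
  rw [Finset.sum_eq_single k]
  · simp [pderiv_X]
  · intro j _ hj
    simp [pderiv_X, hj.symm]
  · simp

theorem act_y (A : Matrix (Fin n) (Fin n) F) (k : Fin n) :
    act A (y k) = - ∑ j, A k j • (y j : Poly n F) := by
  rw [act_apply, Finset.sum_eq_single k]
  · simp [pderiv_X]
  · intro i _ hi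
    simp [pderiv_X, hi.symm]
  · simp

theorem act_single (i j : Fin n) : act (Matrix.single i j (1 : F)) = opE i j := by
  rw [act, Finset.sum_eq_single i, Finset.sum_eq_single j]
  · simp
  · intro b _ hb
    simp [hb.symm]
  · simp
  · intro b _ hb
    simp [hb.symm]
  · simp

theorem act_lie (A B : Matrix (Fin n) (Fin n) F) : act ⁅A, B⁆ = ⁅act A, act B⁆ := by
  refine MvPolynomial.derivation_ext ?_
  rintro (k | k)
  · have h : ∀ P Q : Matrix (Fin n) (Fin n) F,
        act P (act Q (x k)) = ∑ i, (P * Q) i k • (x i : Poly n F) := by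
      intro P Q
      rw [act_x, map_sum]
      simp_rw [Derivation.map_smul, act_x, Matrix.mul_apply, Finset.sum_smul, Finset.smul_sum,
        smul_smul]
      rw [Finset.sum_comm]
      simp_rw [mul_comm]
    rw [Derivation.commutator_apply, h, h, act_x, ← Finset.sum_sub_distrib]
    simp_rw [← sub_smul]
    rfl
  · have h : ∀ P Q : Matrix (Fin n) (Fin n) F,
        act P (act Q (y k)) = ∑ i, (Q * P) k i • (y i : Poly n F) := by
      intro P Q
      rw [act_y, map_neg, map_sum]
      simp_rw [Derivation.map_smul, act_y, Matrix.mul_apply, Finset.sum_smul, smul_neg,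
        Finset.sum_neg_distrib, neg_neg, Finset.smul_sum, smul_smul]
      rw [Finset.sum_comm]
    rw [Derivation.commutator_apply, h, h, act_y, ← Finset.sum_sub_distrib,
      ← Finset.sum_neg_distrib]
    simp_rw [← sub_smul, ← neg_smul]
    refine Finset.sum_congr rfl fun i _ => ?_
    congr 1
    exact neg_sub _ _

variable (n F) in
/-- The representation of the Lie algebra of all `n × n` matrices on `F[x,y]` by derivations. -/
def glRep : Matrix (Fin n) (Fin n) F →ₗ⁅F⁆ Derivation F (Poly n F) (Poly n F) where
  toFun := act
  map_add' A B := by simp [act, add_smul, Finset.sum_add_distrib]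
  map_smul' c A := by simp [act, mul_smul, Finset.smul_sum]
  map_lie' := act_lie _ _

/-- `F[x,y]` as a module over `sl(n,F)`. -/
instance instLieRingModule : LieRingModule (sl (Fin n) F) (Poly n F) :=
  LieRingModule.compLieHom (Poly n F) ((glRep n F).comp (sl (Fin n) F).incl)

instance instLieModule : LieModule F (sl (Fin n) F) (Poly n F) :=
  LieModule.compLieHom (Poly n F) ((glRep n F).comp (sl (Fin n) F).incl)

theorem lie_def (A : sl (Fin n) F) (p : Poly n F) : ⁅A, p⁆ = act A.1 p := rfl

theorem lie_single (i j : Fin n) (h : i ≠ j) (p : Poly n F) :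
    ⁅single i j h (1 : F), p⁆ = x i * dx j p - y j * dy i p := by
  rw [lie_def, val_single, act_single]
  rfl

end Action

section Weights

variable (n : ℕ) (F : Type*) [Field F]

/-- The Cartan subalgebra `H` of `sl(n,F)`, spanned by `E_{i,i} - E_{i+1,i+1}`. -/
def cartan : Submodule F (sl (Fin n) F) :=
  Submodule.span F {h | ∃ i j : Fin n, (j : ℕ) = i + 1 ∧ h = singleSubSingle i j (1 : F)}

/-- The fundamental weight `λ_k` (`1 ≤ k ≤ n-1`), a linear function on `H`: the sum of the first
`k` diagonal entries. It is characterised by `λ_k (E_{i,i} - E_{i+1,i+1}) = δ_{k,i}`, see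
`fundamentalWeight_apply`. -/
def fundamentalWeight (k : ℕ) : Module.Dual F (cartan n F) where
  toFun h := ∑ j : Fin n, if (j : ℕ) < k then (h.1.1 j j : F) else 0
  map_add' a b := by
    rw [← Finset.sum_add_distrib]
    refine Finset.sum_congr rfl fun j _ => ?_
    split_ifs <;> simp
  map_smul' c a := by
    rw [RingHom.id_apply, Finset.smul_sum]
    refine Finset.sum_congr rfl fun j _ => ?_
    split_ifs <;> simp

/-- With `i` zero-based, `E_{i+1,i+1} - E_{i+2,i+2}` in one-based numbering is sent to
`δ_{k,i+1}`. -/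
theorem fundamentalWeight_apply (k : ℕ) (i j : Fin n) (hij : (j : ℕ) = i + 1) :
    fundamentalWeight n F k
      ⟨singleSubSingle i j (1 : F), Submodule.subset_span ⟨i, j, hij, rfl⟩⟩ =
      if k = i + 1 then 1 else 0 := by
  have key : ∀ a : Fin n, (∑ l : Fin n, if (l : ℕ) < k then
      (Matrix.single a a (1 : F)) l l else 0) = if (a : ℕ) < k then 1 else 0 := by
    intro a
    rw [Finset.sum_eq_single a]
    · simp
    · intro b _ hb
      simp [Matrix.single, hb.symm]
    · simp
  have h : fundamentalWeight n F k
      ⟨singleSubSingle i j (1 : F), Submodule.subset_span ⟨i, j, hij, rfl⟩⟩ =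
      (∑ l : Fin n, if (l : ℕ) < k then (Matrix.single i i (1 : F)) l l else 0) -
      (∑ l : Fin n, if (l : ℕ) < k then (Matrix.single j j (1 : F)) l l else 0) := by
    change (∑ l : Fin n, if (l : ℕ) < k then (singleSubSingle i j (1 : F)).1 l l else 0) = _
    rw [← Finset.sum_sub_distrib]
    refine Finset.sum_congr rfl fun l _ => ?_
    split_ifs <;> simp
  rw [h, key, key, hij]
  split_ifs <;> first | omega | simp

variable {n F}

/-- A singular (highest weight) vector of weight `lam`: nonzero, killed by the positive root
vectors `E_{i,j}`, `i < j`, and a weight vector of weight `lam` for the Cartan subalgebra. -/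
structure IsSingularVector {M : Type*} [AddCommGroup M] [Module F M]
    [LieRingModule (sl (Fin n) F) M] (lam : Module.Dual F (cartan n F)) (v : M) : Prop where
  ne_zero : v ≠ 0
  lie_pos : ∀ (i j : Fin n) (hij : i < j), ⁅single i j hij.ne (1 : F), v⁆ = 0
  lie_cartan : ∀ h : cartan n F, ⁅(h : sl (Fin n) F), v⁆ = lam h • v

/-- `M` is a highest weight module of highest weight `lam`: it is generated by a singular vector
of weight `lam`. -/
def IsHighestWeightModule (M : Type*) [AddCommGroup M] [Module F M]
    [LieRingModule (sl (Fin n) F) M] (lam : Module.Dual F (cartan n F)) : Prop :=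
  ∃ v : M, IsSingularVector lam v ∧ LieSubmodule.lieSpan F (sl (Fin n) F) {v} = ⊤

end Weights

section Spaces

/-- The first index (`1` in one-based numbering). -/
def fst {n : ℕ} (hn : 2 ≤ n) : Fin n := ⟨0, by omega⟩

/-- The last index (`n` in one-based numbering). -/
def lst {n : ℕ} (hn : 2 ≤ n) : Fin n := ⟨n - 1, by omega⟩

/-- `x₁^{ℓ₁} yₙ^{ℓ₂}`. -/
def gen {n : ℕ} (hn : 2 ≤ n) (F : Type*) [Field F] (l₁ l₂ : ℕ) : Poly n F :=
  x (fst hn) ^ l₁ * y (lst hn) ^ l₂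

/-- `V_{ℓ₁,ℓ₂}`: the `sl(n,F)`-submodule of `F[x,y]` generated by `x₁^{ℓ₁} yₙ^{ℓ₂}`. -/
def V {n : ℕ} (hn : 2 ≤ n) (F : Type*) [Field F] (l₁ l₂ : ℕ) :
    LieSubmodule F (sl (Fin n) F) (Poly n F) :=
  LieSubmodule.lieSpan F (sl (Fin n) F) {gen hn F l₁ l₂}

variable (n : ℕ) (F : Type*) [Field F]

/-- The polynomials that are homogeneous of degree `ℓ₁` in the `x_i` and of degree `ℓ₂` in the
`y_i` (with `0`). -/
def bihomogeneous (l₁ l₂ : ℕ) : Submodule F (Poly n F) :=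
  weightedHomogeneousSubmodule F
    (Sum.elim (fun _ => ((1, 0) : ℕ × ℕ)) (fun _ => ((0, 1) : ℕ × ℕ))) (l₁, l₂)

/-- `Δ = ∑ ∂_{x_i} ∂_{y_i}`. -/
def Delta : Poly n F →ₗ[F] Poly n F :=
  ∑ i : Fin n, (dx i).toLinearMap ∘ₗ (dy i).toLinearMap

/-- `H_{ℓ₁,ℓ₂}`: the kernel of `Δ` on bihomogeneous polynomials of bidegree `(ℓ₁,ℓ₂)`. -/
def harmonic (l₁ l₂ : ℕ) : Submodule F (Poly n F) :=
  bihomogeneous n F l₁ l₂ ⊓ LinearMap.ker (Delta n F)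

end Spaces

section ExplicitBasis

/-- The indices `2,…,n` (one-based), i.e. all indices but the first. -/
abbrev Rest (n : ℕ) : Type := {r : Fin n // 0 < (r : ℕ)}

variable {n : ℕ} (hn : 2 ≤ n) (F : Type*) [Field F]

/-- The element of the first family. The sum runs over the tuples `i = (i₂,…,iₙ)` with
`i_r ≤ μ_r` and `i_r ≤ ν_r` for all `r`; all other tuples contribute zero since
`(μ_r choose i_r) (ν_r choose i_r)` vanishes for some `r`. -/
def basisFst (m : ℕ) (μ ν : Rest n → ℕ) : Poly n F :=
  ∑ i ∈ Finset.Iic (μ ⊓ ν),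
    C (((-1) ^ (∑ r, i r) * ∏ r, (((μ r).choose (i r) : F) * ((ν r).choose (i r) : F))) /
        (((m + ∑ r, i r).choose m : F) * (Nat.multinomial Finset.univ i : F))) *
      (x (fst hn) ^ (m + ∑ r, i r) * y (fst hn) ^ (∑ r, i r) *
        ∏ r : Rest n, (x r.1 ^ (μ r - i r) * y r.1 ^ (ν r - i r)))

/-- The element of the second family, with the same conventions. -/
def basisSnd (m : ℕ) (μ ν : Rest n → ℕ) : Poly n F :=
  ∑ i ∈ Finset.Iic (μ ⊓ ν),
    C (((-1) ^ (∑ r, i r) * ∏ r, (((μ r).choose (i r) : F) * ((ν r).choose (i r) : F))) /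
        (((m + ∑ r, i r).choose m : F) * (Nat.multinomial Finset.univ i : F))) *
      (x (fst hn) ^ (∑ r, i r) * y (fst hn) ^ (m + ∑ r, i r) *
        ∏ r : Rest n, (x r.1 ^ (μ r - i r) * y r.1 ^ (ν r - i r)))

/-- The union of the two families in bidegree `(ℓ₁,ℓ₂)`, as a set of polynomials. -/
def basisSet (l₁ l₂ : ℕ) : Set (Poly n F) :=
  {f | ∃ (m : ℕ) (μ ν : Rest n → ℕ),
      m + ∑ r, μ r = l₁ ∧ ∑ r, ν r = l₂ ∧ f = basisFst hn F m μ ν} ∪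
  {f | ∃ (m : ℕ) (μ ν : Rest n → ℕ),
      ∑ r, μ r = l₁ ∧ m + ∑ r, ν r = l₂ ∧ f = basisSnd hn F m μ ν}

end ExplicitBasis

end SlPoly

end

/-! ### Coefficients of `X a * pderiv b f` -/

namespace MvPolynomial

variable {σ R : Type*} [CommSemiring R]

/-! Let 𝓗 be the space of harmonic polynomials of bidegree (ℓ₁,ℓ₂), and g = x₁^ℓ₁ yₙ^ℓ₂. Since Δ
commutes with every E_{i,j}, 𝓗 is a submodule containing V. Everything rests on two facts.

Rigidity (`eq_zero_of_Delta_eq_zero`): a harmonic polynomial is determined by its coefficients at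
the monomials not divisible by x₁y₁, because Δf = 0 expresses each other coefficient through ones
with a smaller power of x₁. Each member of the two families is harmonic (`Delta_fam`) and contains
exactly one such monomial, with coefficient 1 (`coeff_fam`). Hence the families are dual to these
monomials, which gives the basis of 𝓗.

Uniqueness of the singular vector (`exists_eq_smul_gen`): comparing coefficients in E_{i,j} f = 0
and Δf = 0 kills all those monomials of f except g, so rigidity makes f a multiple of g. Positive
root vectors raise a height bounded on 𝓗, so every nonzero submodule of 𝓗 contains a singular
vector, hence g, hence V. This is irreducibility of V.

For V = 𝓗, the apolar form makes E_{i,j} and E_{j,i} adjoint, so the orthogonal complement of V in 𝓗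
is a submodule. Were it nonzero it would contain g, but ⟨g,g⟩ is a product of factorials, nonzero in
characteristic 0. So it vanishes, and 𝓗 embeds in the dual of V; comparing dimensions gives
equality. Complete reducibility is not needed. -/

theorem coeff_add_single_X_mul_pderiv (a b : σ) (f : MvPolynomial σ R) (u : σ →₀ ℕ) :
    coeff (u + Finsupp.single a 1) (X a * pderiv b f) =
      coeff (u + Finsupp.single b 1) f * (u b + 1) := by
  rw [add_comm u, coeff_X_mul, coeff_pderiv]

theorem coeff_X_mul_of_apply_eq_zero {a : σ} {t : σ →₀ ℕ} (h : t a = 0) (f : MvPolynomial σ R) :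
    coeff t (X a * f) = 0 := by
  classical
  rw [coeff_X_mul', if_neg (by simpa using h)]

theorem exists_of_coeff_X_mul_pderiv_ne_zero {a b : σ} {f : MvPolynomial σ R} {t : σ →₀ ℕ}
    (h : coeff t (X a * pderiv b f) ≠ 0) :
    ∃ u, t = u + Finsupp.single a 1 ∧ coeff (u + Finsupp.single b 1) f ≠ 0 := by
  by_cases ha : t a = 0
  · exact absurd (coeff_X_mul_of_apply_eq_zero ha _) h
  · obtain ⟨u, rfl⟩ : ∃ u, t = u + Finsupp.single a 1 :=
      ⟨t - Finsupp.single a 1, (Finsupp.sub_add_single_one_cancel ha).symm⟩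
    rw [coeff_add_single_X_mul_pderiv] at h
    exact ⟨u, rfl, left_ne_zero_of_mul h⟩

theorem pderiv_pderiv_comm (a b : σ) (f : MvPolynomial σ R) :
    pderiv a (pderiv b f) = pderiv b (pderiv a f) := by
  classical
  ext u
  rw [coeff_pderiv, coeff_pderiv, coeff_pderiv, coeff_pderiv, add_right_comm]
  rcases eq_or_ne a b with rfl | h
  · rfl
  · simp [h, h.symm, mul_right_comm]

end MvPolynomial

/-! ### The operators E_{i,j}, the Laplacian Δ and the bidegree -/

namespace SlPoly

variable {n : ℕ} {F : Type*} [Field F]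

theorem opE_apply (i j : Fin n) (f : Poly n F) : opE i j f = x i * dx j f - y j * dy i f := rfl

theorem act_eq_sum (A : Matrix (Fin n) (Fin n) F) (f : Poly n F) :
    act A f = ∑ i, ∑ j, A i j • opE i j f := act_apply A f

theorem exists_of_coeff_opE_ne_zero {i j : Fin n} {f : Poly n F} {t : Fin n ⊕ Fin n →₀ ℕ}
    (h : coeff t (opE i j f) ≠ 0) :
    ∃ u, (t = u + Finsupp.single (.inl i) 1 ∧ coeff (u + Finsupp.single (.inl j) 1) f ≠ 0) ∨
      (t = u + Finsupp.single (.inr j) 1 ∧ coeff (u + Finsupp.single (.inr i) 1) f ≠ 0) := by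
  rw [opE_apply, coeff_sub] at h
  by_cases h1 : coeff t (x i * dx j f) = 0
  · rw [h1, zero_sub, neg_ne_zero] at h
    obtain ⟨u, hu⟩ := exists_of_coeff_X_mul_pderiv_ne_zero h
    exact ⟨u, .inr hu⟩
  · obtain ⟨u, hu⟩ := exists_of_coeff_X_mul_pderiv_ne_zero h1
    exact ⟨u, .inl hu⟩

theorem Delta_apply (f : Poly n F) : Delta n F f = ∑ k, dx k (dy k f) := by
  simp [Delta]

theorem coeff_Delta (f : Poly n F) (u : Fin n ⊕ Fin n →₀ ℕ) :
    coeff u (Delta n F f) = ∑ k : Fin n,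
      coeff (u + Finsupp.single (.inl k) 1 + Finsupp.single (.inr k) 1) f *
        (u (.inr k) + 1) * (u (.inl k) + 1) := by
  rw [Delta_apply, coeff_sum]
  refine Finset.sum_congr rfl fun k _ => ?_
  rw [coeff_pderiv, coeff_pderiv]
  simp

/-- The commutator of ∂_{x_k}∂_{y_k} with E_{i,j} is δ_{ki} ∂_{y_k}∂_{x_j} - δ_{kj} ∂_{x_k}∂_{y_i};
summed over k, the two contributions cancel. -/
theorem Delta_opE (i j : Fin n) (f : Poly n F) :
    Delta n F (opE i j f) = opE i j (Delta n F f) := by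
  have h1 : ∀ k, dx k (dy k (opE i j f)) = opE i j (dx k (dy k f)) +
      ((if k = i then dy k (dx j f) else 0) - if k = j then dx k (dy i f) else 0) := by
    intro k
    have hx : dx k (x i : Poly n F) = if k = i then 1 else 0 := by
      simp [pderiv_X, Pi.single_apply, eq_comm]
    have hy : dy k (y j : Poly n F) = if k = j then 1 else 0 := by
      simp [pderiv_X, Pi.single_apply, eq_comm]
    have hx' : dy k (x i : Poly n F) = 0 := pderiv_X_of_ne (by simp)
    have hy' : dx k (y j : Poly n F) = 0 := pderiv_X_of_ne (by simp)
    rw [opE_apply, opE_apply]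
    simp only [map_sub, Derivation.leibniz, map_add, hx, hy, hx', hy', smul_eq_mul,
      mul_zero, add_zero]
    have e1 : dx k (dy k (dx j f)) = dx j (dx k (dy k f)) :=
      (congrArg (dx k) (pderiv_pderiv_comm _ _ f)).trans (pderiv_pderiv_comm _ _ _)
    have e2 : dx k (dy k (dy i f)) = dy i (dx k (dy k f)) :=
      (congrArg (dx k) (pderiv_pderiv_comm _ _ f)).trans (pderiv_pderiv_comm _ _ _)
    rw [e1, e2]
    split_ifs <;> simp <;> ring
  rw [Delta_apply, Delta_apply, Finset.sum_congr rfl fun k _ => h1 k, Finset.sum_add_distrib,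
    Finset.sum_sub_distrib, map_sum]
  simp [pderiv_pderiv_comm (Sum.inl j : Fin n ⊕ Fin n) (Sum.inr i) f]

theorem weight_bideg (s : Fin n ⊕ Fin n →₀ ℕ) :
    Finsupp.weight (Sum.elim (fun _ => ((1, 0) : ℕ × ℕ)) (fun _ => ((0, 1) : ℕ × ℕ))) s =
      (∑ k, s (.inl k), ∑ k, s (.inr k)) := by
  rw [Finsupp.weight_eq_sum]
  ext <;> simp [Prod.fst_sum, Prod.snd_sum]

theorem mem_bihomogeneous_iff {l₁ l₂ : ℕ} {f : Poly n F} :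
    f ∈ bihomogeneous n F l₁ l₂ ↔ ∀ s, coeff s f ≠ 0 →
      ∑ k, s (.inl k) = l₁ ∧ ∑ k, s (.inr k) = l₂ := by
  rw [bihomogeneous, mem_weightedHomogeneousSubmodule, IsWeightedHomogeneous]
  simp only [weight_bideg, Prod.mk.injEq]

theorem opE_mem_harmonic {l₁ l₂ : ℕ} {f : Poly n F} (i j : Fin n) (hf : f ∈ harmonic n F l₁ l₂) :
    opE i j f ∈ harmonic n F l₁ l₂ := by
  classical
  refine ⟨mem_bihomogeneous_iff.2 fun s hs => ?_, ?_⟩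
  · obtain ⟨u, ⟨rfl, h⟩ | ⟨rfl, h⟩⟩ := exists_of_coeff_opE_ne_zero hs <;>
    · obtain ⟨rfl, rfl⟩ := mem_bihomogeneous_iff.1 hf.1 _ h
      simp [Finsupp.single_apply, Finset.sum_add_distrib]
  · have := hf.2
    rw [SetLike.mem_coe, LinearMap.mem_ker] at this ⊢
    rw [Delta_opE, this, map_zero]

theorem act_mem {N : Submodule F (Poly n F)} (A : Matrix (Fin n) (Fin n) F) {f : Poly n F}
    (hN : ∀ i j, opE i j f ∈ N) : act A f ∈ N := by
  rw [act_eq_sum]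
  exact N.sum_mem fun i _ => N.sum_mem fun j _ => N.smul_mem _ (hN i j)

/-- The harmonic polynomials as an `sl(n,F)`-submodule. -/
noncomputable def harmonicLie (n : ℕ) (F : Type*) [Field F] (l₁ l₂ : ℕ) :
    LieSubmodule F (sl (Fin n) F) (Poly n F) where
  __ := harmonic n F l₁ l₂
  lie_mem {A _} hf := act_mem (N := harmonic n F l₁ l₂) A.1 fun i j => opE_mem_harmonic i j hf

theorem gen_eq_monomial (hn : 2 ≤ n) (l₁ l₂ : ℕ) :
    gen hn F l₁ l₂ = monomial
      (Finsupp.single (.inl (fst hn)) l₁ + Finsupp.single (.inr (lst hn)) l₂) 1 := by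
  rw [gen, X_pow_eq_monomial, X_pow_eq_monomial, monomial_mul, one_mul]

theorem fst_ne_lst (hn : 2 ≤ n) : fst hn ≠ lst hn := by
  simp [fst, lst, Fin.ext_iff]; omega

theorem gen_mem_harmonic (hn : 2 ≤ n) (l₁ l₂ : ℕ) : gen hn F l₁ l₂ ∈ harmonic n F l₁ l₂ := by
  classical
  refine ⟨mem_bihomogeneous_iff.2 fun s hs => ?_, ?_⟩
  · rw [gen_eq_monomial, coeff_monomial] at hs
    obtain rfl := (ite_ne_right_iff.1 hs).1
    simp [Finsupp.single_apply]
  · rw [SetLike.mem_coe, LinearMap.mem_ker, Delta_apply]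
    refine Finset.sum_eq_zero fun k _ => ?_
    rw [gen_eq_monomial, pderiv_monomial, pderiv_monomial]
    by_cases h1 : fst hn = k
    · simp [← h1, (fst_ne_lst hn).symm]
    · simp [h1]

/-! ### Rigidity and singular vectors among harmonic polynomials -/

theorem exists_eq_add_single {σ : Type*} {s : σ →₀ ℕ} {a : σ} (h : s a ≠ 0) :
    ∃ u, s = u + Finsupp.single a 1 :=
  ⟨s - Finsupp.single a 1, (Finsupp.sub_add_single_one_cancel h).symm⟩

/-- Induction on the exponent of x_p. If s = u + x_p + y_p, the coefficient of Δf at u involves s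
and the exponents u + x_k + y_k with k ≠ p, whose x_p-exponent is one less. -/
theorem eq_zero_of_Delta_eq_zero [CharZero F] (p : Fin n) {f : Poly n F} (hf : Delta n F f = 0)
    (h : ∀ s, s (.inl p) = 0 ∨ s (.inr p) = 0 → coeff s f = 0) : f = 0 := by
  classical
  suffices H : ∀ a s, s (.inl p) = a → coeff s f = 0 by
    ext s
    simpa using H _ s rfl
  intro a
  induction a with
  | zero => exact fun s hs => h s (.inl hs)
  | succ a ih =>
    intro s hs
    by_cases hy : s (.inr p) = 0
    · exact h s (.inr hy)
    obtain ⟨v, rfl⟩ := exists_eq_add_single hy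
    obtain ⟨u, rfl⟩ := exists_eq_add_single (s := v) (a := .inl p) (by simp at hs; omega)
    have hu := coeff_Delta f u
    rw [hf, coeff_zero, Finset.sum_eq_single p] at hu
    · rw [eq_comm, mul_eq_zero, mul_eq_zero] at hu
      refine (hu.resolve_right ?_).resolve_right ?_ <;> exact Nat.cast_add_one_ne_zero _
    · intro k _ hk
      rw [ih, zero_mul, zero_mul]
      simp at hs
      simp [hk, hs]
    · simp

/-- In E_{1,n} f = 0, the part x₁∂_{x_n} f cannot contribute to a monomial free of x₁, so y_n∂_{y_1}
f must vanish there. -/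
theorem coeff_eq_zero_of_inl_eq_zero [CharZero F] (hn : 2 ≤ n) {f : Poly n F}
    (hf : ∀ i j, i < j → opE i j f = 0) {u : Fin n ⊕ Fin n →₀ ℕ} (hu : u (.inl (fst hn)) = 0) :
    coeff (u + Finsupp.single (.inr (fst hn)) 1) f = 0 := by
  have h := congrArg (coeff (u + Finsupp.single (.inr (lst hn)) 1))
    (hf (fst hn) (lst hn) (by simp [fst, lst, Fin.lt_def]; omega))
  rw [opE_apply, coeff_sub, coeff_X_mul_of_apply_eq_zero (by simp [hu]),
    coeff_add_single_X_mul_pderiv, coeff_zero, zero_sub, neg_eq_zero, mul_eq_zero] at h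
  exact h.resolve_right (Nat.cast_add_one_ne_zero _)

theorem fst_lt {hn : 2 ≤ n} {r : Fin n} (h : r ≠ fst hn) : fst hn < r := by
  simp only [fst, ne_eq, Fin.ext_iff, Fin.lt_def] at h ⊢
  omega

theorem lt_lst {hn : 2 ≤ n} {r : Fin n} (h : r ≠ lst hn) : r < lst hn := by
  simp only [lst, ne_eq, Fin.ext_iff, Fin.lt_def] at h ⊢
  omega

/-- Let c be the coefficient in question. The equations E_{1,r} f = 0 express the coefficients at u
+ x_r + y_r through c, and Δf = 0 at u becomes c times a natural number that is positive because of
the summand u(x₁) + 1. -/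
theorem coeff_eq_zero_of_inr_eq_zero [CharZero F] (hn : 2 ≤ n) {f : Poly n F}
    (hD : Delta n F f = 0) (hf : ∀ i j, i < j → opE i j f = 0) {u : Fin n ⊕ Fin n →₀ ℕ}
    (hu : u (.inr (fst hn)) = 0) :
    coeff (u + Finsupp.single (.inl (fst hn)) 1 + Finsupp.single (.inr (fst hn)) 1) f = 0 := by
  classical
  set c := coeff (u + Finsupp.single (.inl (fst hn)) 1 + Finsupp.single (.inr (fst hn)) 1) f with hc
  have key : ∀ r, r ≠ fst hn →
      coeff (u + Finsupp.single (.inl r) 1 + Finsupp.single (.inr r) 1) f * (u (.inl r) + 1) =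
        c := by
    intro r hr
    have h := congrArg (coeff (u + Finsupp.single (.inl (fst hn)) 1 + Finsupp.single (.inr r) 1))
      (hf (fst hn) r (fst_lt hr))
    rw [opE_apply, coeff_sub, coeff_add_single_X_mul_pderiv, add_right_comm,
      coeff_add_single_X_mul_pderiv, coeff_zero, sub_eq_zero, add_right_comm] at h
    simpa [hu, hr] using h
  have hsum := coeff_Delta f u
  rw [hD, coeff_zero] at hsum
  have : ∀ k : Fin n, coeff (u + Finsupp.single (.inl k) 1 + Finsupp.single (.inr k) 1) f *
        (u (.inr k) + 1) * (u (.inl k) + 1) =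
        c * ((if k = fst hn then u (.inl k) + 1 else u (.inr k) + 1 : ℕ) : F) := by
    intro k
    split_ifs with hk
    · subst hk
      simp [hu, hc]
    · rw [mul_right_comm, key k hk]
      push_cast
      rfl
  rw [Finset.sum_congr rfl fun k _ => this k, ← Finset.mul_sum, ← Nat.cast_sum, eq_comm,
    mul_eq_zero] at hsum
  refine hsum.resolve_right (Nat.cast_ne_zero.2 ?_)
  rw [Ne, Finset.sum_eq_zero_iff]
  intro h
  simpa using h (fst hn) (Finset.mem_univ _)

/-- A harmonic polynomial killed by the positive root vectors is a multiple of `x₁^{ℓ₁} yₙ^{ℓ₂}`. -/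
theorem exists_eq_smul_gen [CharZero F] (hn : 2 ≤ n) {l₁ l₂ : ℕ} {f : Poly n F}
    (hh : f ∈ harmonic n F l₁ l₂) (hf : ∀ i j, i < j → opE i j f = 0) :
    ∃ c : F, f = c • gen hn F l₁ l₂ := by
  classical
  set t : Fin n ⊕ Fin n →₀ ℕ :=
    Finsupp.single (.inl (fst hn)) l₁ + Finsupp.single (.inr (lst hn)) l₂ with ht
  have hD : Delta n F f = 0 := hh.2
  have key : ∀ s, s (.inl (fst hn)) = 0 ∨ s (.inr (fst hn)) = 0 → s ≠ t → coeff s f = 0 := by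
    intro s hs hst
    by_contra hne
    have hy : s (.inr (fst hn)) = 0 := by
      rcases hs with hs | hs
      · by_contra hy
        obtain ⟨u, rfl⟩ := exists_eq_add_single hy
        exact hne (coeff_eq_zero_of_inl_eq_zero hn hf (by simpa using hs))
      · exact hs
    have hx : ∀ r, r ≠ fst hn → s (.inl r) = 0 := by
      intro r hr
      by_contra hsr
      obtain ⟨u, rfl⟩ := exists_eq_add_single hsr
      have h := congrArg (coeff (u + Finsupp.single (.inl (fst hn)) 1))
        (hf (fst hn) r (fst_lt hr))
      rw [opE_apply, coeff_sub, coeff_add_single_X_mul_pderiv, coeff_zero, sub_eq_zero] at h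
      -- A contribution here would come from a monomial of f containing x₁ and y₁, with y₁ to the
      -- first power only; these are excluded by `coeff_eq_zero_of_inr_eq_zero`.
      have h0 : coeff (u + Finsupp.single (.inl (fst hn)) 1) (y r * dy (fst hn) f) = 0 := by
        by_cases hur : u (.inr r) = 0
        · exact coeff_X_mul_of_apply_eq_zero (by simp [hur]) _
        · obtain ⟨v, rfl⟩ := exists_eq_add_single hur
          rw [add_right_comm, coeff_add_single_X_mul_pderiv,
            coeff_eq_zero_of_inr_eq_zero hn hD hf, zero_mul]
          simpa [hr] using hy
      rw [h0, mul_eq_zero] at h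
      exact hne (h.resolve_right (Nat.cast_add_one_ne_zero _))
    have hy' : ∀ r, r ≠ lst hn → s (.inr r) = 0 := by
      intro r hr
      by_contra hsr
      have hrf : r ≠ fst hn := by rintro rfl; exact hsr hy
      obtain ⟨u, rfl⟩ := exists_eq_add_single hsr
      have h := congrArg (coeff (u + Finsupp.single (.inr (lst hn)) 1))
        (hf r (lst hn) (lt_lst hr))
      rw [opE_apply, coeff_sub, coeff_add_single_X_mul_pderiv, coeff_zero,
        coeff_X_mul_of_apply_eq_zero (by simpa using hx r hrf), zero_sub, neg_eq_zero,
        mul_eq_zero] at h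
      exact hne (h.resolve_right (Nat.cast_add_one_ne_zero _))
    obtain ⟨h1, h2⟩ := mem_bihomogeneous_iff.1 hh.1 s hne
    rw [Finset.sum_eq_single (fst hn) (fun r _ hr => hx r hr) (by simp)] at h1
    rw [Finset.sum_eq_single (lst hn) (fun r _ hr => hy' r hr) (by simp)] at h2
    apply hst
    ext (r | r)
    · by_cases hr : r = fst hn
      · subst hr; simp [ht, h1]
      · simp [ht, hx r hr, hr]
    · by_cases hr : r = lst hn
      · subst hr; simp [ht, h2]
      · simp [ht, hy' r hr, hr]
  -- Subtracting the right multiple of the generator removes the last monomial without x₁y₁, and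
  -- rigidity applies.
  refine ⟨coeff t f, sub_eq_zero.1 (eq_zero_of_Delta_eq_zero (fst hn) ?_ fun s hs => ?_)⟩
  · have hg : Delta n F (gen hn F l₁ l₂) = 0 := (gen_mem_harmonic hn l₁ l₂).2
    rw [map_sub, map_smul, hD, hg, smul_zero, sub_zero]
  · rw [coeff_sub, coeff_smul, gen_eq_monomial, ← ht, coeff_monomial]
    split_ifs with hst
    · simp [hst]
    · simp [key s hs (Ne.symm hst)]

/-! ### Every nonzero stable subspace contains the generator -/

/-- A grading of the monomials which the positive root vectors raise. -/
def height (s : Fin n ⊕ Fin n →₀ ℕ) : ℕ :=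
  ∑ k : Fin n, (s (.inl k) * (n - 1 - k) + s (.inr k) * k)

theorem height_add_single_inl (u : Fin n ⊕ Fin n →₀ ℕ) (i : Fin n) :
    height (u + Finsupp.single (.inl i) 1) = height u + (n - 1 - i) := by
  classical
  simp [height, Finsupp.single_apply, add_mul, Finset.sum_add_distrib]
  ring

theorem height_add_single_inr (u : Fin n ⊕ Fin n →₀ ℕ) (i : Fin n) :
    height (u + Finsupp.single (.inr i) 1) = height u + i := by
  classical
  simp [height, Finsupp.single_apply, add_mul, Finset.sum_add_distrib]
  ring

theorem height_le (s : Fin n ⊕ Fin n →₀ ℕ) :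
    height s ≤ (∑ k, s (.inl k)) * n + (∑ k, s (.inr k)) * n := by
  rw [height, Finset.sum_mul, Finset.sum_mul, ← Finset.sum_add_distrib]
  gcongr with k
  · omega
  · omega

theorem exists_height_lt_of_coeff_opE_ne_zero {i j : Fin n} (hij : i < j) {f : Poly n F}
    {t : Fin n ⊕ Fin n →₀ ℕ} (h : coeff t (opE i j f) ≠ 0) :
    ∃ s, coeff s f ≠ 0 ∧ height s < height t := by
  obtain ⟨u, ⟨rfl, hs⟩ | ⟨rfl, hs⟩⟩ := exists_of_coeff_opE_ne_zero h
  · refine ⟨_, hs, ?_⟩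
    rw [height_add_single_inl, height_add_single_inl]
    have := j.2
    rw [Fin.lt_def] at hij
    omega
  · refine ⟨_, hs, ?_⟩
    rw [height_add_single_inr, height_add_single_inr]
    simpa using hij

theorem exists_singular {l₁ l₂ : ℕ} {N : Submodule F (Poly n F)} (hN : N ≤ harmonic n F l₁ l₂)
    (hst : ∀ i j, i < j → ∀ f ∈ N, opE i j f ∈ N) (hbot : N ≠ ⊥) :
    ∃ f ∈ N, f ≠ 0 ∧ ∀ i j, i < j → opE i j f = 0 := by
  -- Here d measures how far the lowest height in f may lie below the bound of `height_le`. Each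
  -- positive root vector lowers d by one, and d = 0 contradicts that bound.
  suffices H : ∀ d, ∀ f ∈ N, f ≠ 0 → (∀ s, coeff s f ≠ 0 → l₁ * n + l₂ * n < height s + d) →
      ∃ f ∈ N, f ≠ 0 ∧ ∀ i j, i < j → opE i j f = 0 by
    obtain ⟨f, hf, hf0⟩ := N.ne_bot_iff.1 hbot
    exact H (l₁ * n + l₂ * n + 1) f hf hf0 fun s _ => by omega
  intro d
  induction d with
  | zero =>
    intro f hf hf0 h
    obtain ⟨s, hs⟩ := ne_zero_iff.1 hf0
    obtain ⟨h1, h2⟩ := mem_bihomogeneous_iff.1 (hN hf).1 s hs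
    have h3 := height_le s
    have h4 := h s hs
    rw [h1, h2] at h3
    omega
  | succ d ih =>
    intro f hf hf0 h
    by_cases hs : ∀ i j, i < j → opE i j f = 0
    · exact ⟨f, hf, hf0, hs⟩
    push Not at hs
    obtain ⟨i, j, hij, hne⟩ := hs
    refine ih _ (hst i j hij f hf) hne fun t ht => ?_
    obtain ⟨s, hs, hlt⟩ := exists_height_lt_of_coeff_opE_ne_zero hij ht
    have := h s hs
    omega

theorem gen_mem_of_ne_bot [CharZero F] (hn : 2 ≤ n) {l₁ l₂ : ℕ} {N : Submodule F (Poly n F)}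
    (hN : N ≤ harmonic n F l₁ l₂) (hst : ∀ i j, i < j → ∀ f ∈ N, opE i j f ∈ N) (hbot : N ≠ ⊥) :
    gen hn F l₁ l₂ ∈ N := by
  obtain ⟨f, hf, hf0, hs⟩ := exists_singular hN hst hbot
  obtain ⟨c, rfl⟩ := exists_eq_smul_gen hn (hN hf) hs
  exact (N.smul_mem_iff (left_ne_zero_of_smul hf0)).1 hf

end SlPoly

/-! ### The apolar form -/

namespace MvPolynomial

variable {σ F : Type*} [Fintype σ] [Field F]

/-- The bilinear form for which the monomials are orthogonal and multiplication by a variable is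
adjoint to the corresponding partial derivative. -/
noncomputable def apolar : MvPolynomial σ F →ₗ[F] MvPolynomial σ F →ₗ[F] F :=
  (basisMonomials σ F).constr F fun s => (∏ i, ((s i).factorial : F)) • lcoeff F s

theorem apolar_monomial (s : σ →₀ ℕ) (a : F) (g : MvPolynomial σ F) :
    apolar (monomial s a) g = a * ((∏ i, ((s i).factorial : F)) * coeff s g) := by
  have : monomial s a = a • basisMonomials σ F s := by simp [smul_monomial]
  rw [this, map_smul, apolar, Module.Basis.constr_basis]
  rfl

theorem apolar_symm (f g : MvPolynomial σ F) : apolar f g = apolar g f := by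
  classical
  induction f using MvPolynomial.induction_on' with
  | add p q hp hq => rw [map_add, map_add, LinearMap.add_apply, hp, hq]
  | monomial s a =>
    induction g using MvPolynomial.induction_on' with
    | add p q hp hq => rw [map_add, map_add, LinearMap.add_apply, hp, hq]
    | monomial t b =>
      rw [apolar_monomial, apolar_monomial, coeff_monomial, coeff_monomial]
      by_cases h : s = t
      · subst h
        simp
        ring
      · simp [h, Ne.symm h]

/-- Raising the i-th exponent multiplies the factorial weight of a monomial by s_i + 1, which is the
factor produced by differentiating. -/
theorem apolar_X_mul (i : σ) (f g : MvPolynomial σ F) :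
    apolar (X i * f) g = apolar f (pderiv i g) := by
  classical
  induction f using MvPolynomial.induction_on' with
  | add p q hp hq => rw [mul_add, map_add, map_add, LinearMap.add_apply, LinearMap.add_apply, hp, hq]
  | monomial s a =>
    have h : ∏ k, ((((s + Finsupp.single i 1 : σ →₀ ℕ) k).factorial : ℕ) : F) =
        (∏ k, ((s k).factorial : F)) * (s i + 1) := by
      rw [← Finset.mul_prod_erase _ _ (Finset.mem_univ i),
        ← Finset.mul_prod_erase _ (fun k => ((s k).factorial : F)) (Finset.mem_univ i),
        Finset.prod_congr rfl (g := fun k => ((s k).factorial : F))]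
      · simp [Nat.factorial_succ]
        ring
      · intro k hk
        simp [(Finset.ne_of_mem_erase hk).symm]
    rw [X, monomial_mul, one_mul, apolar_monomial, apolar_monomial, coeff_pderiv, add_comm _ s, h]
    ring

theorem apolar_pderiv (i : σ) (f g : MvPolynomial σ F) :
    apolar (pderiv i f) g = apolar f (X i * g) := by
  rw [apolar_symm, ← apolar_X_mul, apolar_symm]

end MvPolynomial

namespace SlPoly

variable {n : ℕ} {F : Type*} [Field F]

/-- The form is contravariant: transposing a matrix gives the adjoint operator. This makes
orthogonal complements of submodules stable. -/
theorem apolar_opE (i j : Fin n) (f g : Poly n F) : apolar (opE i j f) g = apolar f (opE j i g) := by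
  rw [opE_apply, opE_apply, map_sub, LinearMap.sub_apply, map_sub, apolar_X_mul, apolar_pderiv,
    apolar_X_mul, apolar_pderiv]

/-! ### The two explicit families -/

theorem ne_fst_iff {hn : 2 ≤ n} {k : Fin n} : k ≠ fst hn ↔ 0 < (k : ℕ) := by
  simp only [fst, ne_eq, Fin.ext_iff]
  omega

theorem rest_ne_fst {hn : 2 ≤ n} (r : Rest n) : r.1 ≠ fst hn := ne_fst_iff.2 r.2

theorem sum_eq_fst_add {M : Type*} [AddCommMonoid M] (hn : 2 ≤ n) (g : Fin n → M) :
    ∑ k, g k = g (fst hn) + ∑ r : Rest n, g r.1 := by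
  classical
  rw [← Finset.add_sum_erase _ _ (Finset.mem_univ (fst hn))]
  congr 1
  exact Finset.sum_subtype _ (fun k => by simp [ne_fst_iff]) _

theorem prod_eq_fst_mul {M : Type*} [CommMonoid M] (hn : 2 ≤ n) (g : Fin n → M) :
    ∏ k, g k = g (fst hn) * ∏ r : Rest n, g r.1 := by
  classical
  rw [← Finset.mul_prod_erase _ _ (Finset.mem_univ (fst hn))]
  congr 1
  exact Finset.prod_subtype _ (fun k => by simp [ne_fst_iff]) _

/-- The exponent of `x₁^{a+|i|} y₁^{b+|i|} ∏ x_r^{μ_r - i_r} y_r^{ν_r - i_r}`. -/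
noncomputable def expo (a b : ℕ) (μ ν i : Rest n → ℕ) : Fin n ⊕ Fin n →₀ ℕ :=
  Finsupp.equivFunOnFinite.symm <| Sum.elim
    (fun k => if h : 0 < (k : ℕ) then μ ⟨k, h⟩ - i ⟨k, h⟩ else a + ∑ r, i r)
    (fun k => if h : 0 < (k : ℕ) then ν ⟨k, h⟩ - i ⟨k, h⟩ else b + ∑ r, i r)

section expo

variable (a b : ℕ) (μ ν i : Rest n → ℕ)

@[simp] theorem expo_inl_fst (hn : 2 ≤ n) : expo a b μ ν i (.inl (fst hn)) = a + ∑ r, i r := by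
  simp [expo, fst]

@[simp] theorem expo_inr_fst (hn : 2 ≤ n) : expo a b μ ν i (.inr (fst hn)) = b + ∑ r, i r := by
  simp [expo, fst]

@[simp] theorem expo_inl_rest (r : Rest n) : expo a b μ ν i (.inl r.1) = μ r - i r := by
  simp [expo, r.2]

@[simp] theorem expo_inr_rest (r : Rest n) : expo a b μ ν i (.inr r.1) = ν r - i r := by
  simp [expo, r.2]

theorem expo_ext (hn : 2 ≤ n) {s t : Fin n ⊕ Fin n →₀ ℕ}
    (h1 : s (.inl (fst hn)) = t (.inl (fst hn))) (h2 : s (.inr (fst hn)) = t (.inr (fst hn)))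
    (h3 : ∀ r : Rest n, s (.inl r.1) = t (.inl r.1))
    (h4 : ∀ r : Rest n, s (.inr r.1) = t (.inr r.1)) : s = t := by
  ext (k | k)
  · by_cases hk : k = fst hn
    · rw [hk, h1]
    · exact h3 ⟨k, ne_fst_iff.1 hk⟩
  · by_cases hk : k = fst hn
    · rw [hk, h2]
    · exact h4 ⟨k, ne_fst_iff.1 hk⟩

theorem monomial_expo (hn : 2 ≤ n) (c : F) :
    monomial (expo a b μ ν i) c = C c *
      (x (fst hn) ^ (a + ∑ r, i r) * y (fst hn) ^ (b + ∑ r, i r) *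
        ∏ r : Rest n, (x r.1 ^ (μ r - i r) * y r.1 ^ (ν r - i r))) := by
  rw [monomial_eq, Finsupp.prod_fintype _ _ (fun _ => pow_zero _), Fintype.prod_sum_type,
    prod_eq_fst_mul hn, prod_eq_fst_mul hn, Finset.prod_mul_distrib]
  simp only [expo_inl_fst, expo_inr_fst, expo_inl_rest, expo_inr_rest]
  ring

end expo

/-- The coefficient in the two families of harmonic polynomials. -/
noncomputable def fcoeff (F : Type*) [Field F] (m : ℕ) (μ ν i : Rest n → ℕ) : F :=
  ((-1) ^ (∑ r, i r) * ∏ r, (((μ r).choose (i r) : F) * ((ν r).choose (i r) : F))) /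
    (((m + ∑ r, i r).choose m : F) * (Nat.multinomial Finset.univ i : F))

/-- The common generalization of the two families. -/
noncomputable def fam (F : Type*) [Field F] (a b : ℕ) (μ ν : Rest n → ℕ) : Poly n F :=
  ∑ i ∈ Finset.Iic (μ ⊓ ν), monomial (expo a b μ ν i) (fcoeff F (a + b) μ ν i)

theorem basisFst_eq_fam (hn : 2 ≤ n) (m : ℕ) (μ ν : Rest n → ℕ) :
    basisFst hn F m μ ν = fam F m 0 μ ν := by
  refine Finset.sum_congr rfl fun i _ => ?_
  rw [monomial_expo _ _ _ _ _ hn, add_zero, zero_add]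
  rfl

theorem basisSnd_eq_fam (hn : 2 ≤ n) (m : ℕ) (μ ν : Rest n → ℕ) :
    basisSnd hn F m μ ν = fam F 0 m μ ν := by
  refine Finset.sum_congr rfl fun i _ => ?_
  rw [monomial_expo _ _ _ _ _ hn, zero_add, zero_add]
  rfl

theorem fcoeff_zero (m : ℕ) (μ ν : Rest n → ℕ) : fcoeff F m μ ν 0 = 1 := by
  simp [fcoeff, Nat.multinomial]

/-- Each term with i ≠ 0 is divisible by x₁y₁, so only i = 0 is visible at such exponents. -/
theorem coeff_fam (hn : 2 ≤ n) {a b : ℕ} (μ ν : Rest n → ℕ) {t : Fin n ⊕ Fin n →₀ ℕ}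
    (ht : t (.inl (fst hn)) = 0 ∨ t (.inr (fst hn)) = 0) :
    coeff t (fam F a b μ ν) = if expo a b μ ν 0 = t then 1 else 0 := by
  classical
  rw [fam, coeff_sum, Finset.sum_eq_single 0]
  · rw [coeff_monomial, fcoeff_zero]
  · intro i _ hi
    rw [coeff_monomial, if_neg]
    rintro rfl
    rw [expo_inl_fst, expo_inr_fst] at ht
    have h0 : ∑ r, i r = 0 := by omega
    rw [Finset.sum_eq_zero_iff] at h0
    exact hi (funext fun r => h0 r (Finset.mem_univ r))
  · intro h
    exact absurd (Finset.mem_Iic.2 fun r => Nat.zero_le _) h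

theorem fam_mem_bihomogeneous (hn : 2 ≤ n) (a b : ℕ) (μ ν : Rest n → ℕ) :
    fam F a b μ ν ∈ bihomogeneous n F (a + ∑ r, μ r) (b + ∑ r, ν r) := by
  classical
  refine Submodule.sum_mem _ fun i hi => mem_bihomogeneous_iff.2 fun s hs => ?_
  rw [coeff_monomial] at hs
  obtain rfl := (ite_ne_right_iff.1 hs).1
  have hi' := Finset.mem_Iic.1 hi
  have h1 : ∀ r, i r ≤ μ r := fun r => (hi' r).trans inf_le_left
  have h2 : ∀ r, i r ≤ ν r := fun r => (hi' r).trans inf_le_right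
  rw [sum_eq_fst_add hn, sum_eq_fst_add hn]
  simp only [expo_inl_fst, expo_inr_fst, expo_inl_rest, expo_inr_rest]
  rw [add_assoc, add_assoc, ← Finset.sum_add_distrib, ← Finset.sum_add_distrib]
  exact ⟨by simp only [Nat.add_sub_cancel' (h1 _)], by simp only [Nat.add_sub_cancel' (h2 _)]⟩

/-- Cancelling |i|! between the binomial and the multinomial leaves a product over r times a factor
depending on |i| alone, a form suited to changing one i_r. -/
theorem fcoeff_eq [CharZero F] (m : ℕ) (μ ν i : Rest n → ℕ) :
    fcoeff F m μ ν i = (-1) ^ (∑ r, i r) * m.factorial / (m + ∑ r, i r).factorial *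
      ∏ r, ((i r).factorial * ((μ r).choose (i r) : F) * ((ν r).choose (i r) : F)) := by
  have h1 : ((m + ∑ r, i r).choose m : F) * m.factorial * (∑ r, i r).factorial =
      (m + ∑ r, i r).factorial := by
    rw [Nat.choose_symm_add]
    exact_mod_cast Nat.add_choose_mul_factorial_mul_factorial m (∑ r, i r)
  have h2 : (∏ r, ((i r).factorial : F)) * (Nat.multinomial Finset.univ i : F) =
      (∑ r, i r).factorial := by
    exact_mod_cast Nat.multinomial_spec Finset.univ i
  have hm : (m.factorial : F) ≠ 0 := by exact_mod_cast m.factorial_ne_zero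
  have hp : (∏ r, ((i r).factorial : F)) ≠ 0 :=
    Finset.prod_ne_zero_iff.2 fun r _ => by exact_mod_cast (i r).factorial_ne_zero
  have h3 : ((m + ∑ r, i r).factorial : F) ≠ 0 := by exact_mod_cast Nat.factorial_ne_zero _
  rw [← h1, ← h2] at h3
  have hc := left_ne_zero_of_mul (left_ne_zero_of_mul h3)
  have hq := right_ne_zero_of_mul (right_ne_zero_of_mul h3)
  simp only [fcoeff, mul_assoc, Finset.prod_mul_distrib]
  rw [← h1, ← h2]
  field_simp

/-- This recursion is what annihilation by Δ amounts to; see `Delta_fam`. -/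
theorem fcoeff_add_single [CharZero F] (m : ℕ) (μ ν i : Rest n → ℕ) (r : Rest n) :
    fcoeff F m μ ν (i + Pi.single r 1) * (m + ∑ q, i q + 1) * (i r + 1) =
      - (fcoeff F m μ ν i * ((μ r - i r : ℕ) : F) * ((ν r - i r : ℕ) : F)) := by
  classical
  have hs : ∑ q, (i + Pi.single r 1 : Rest n → ℕ) q = ∑ q, i q + 1 := by
    simp [Finset.sum_add_distrib]
  have hp : ∀ g : ℕ → ℕ → ℕ → F, ∏ q, g (μ q) (ν q) ((i + Pi.single r 1 : Rest n → ℕ) q) =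
      g (μ r) (ν r) (i r + 1) * ∏ q ∈ Finset.univ.erase r, g (μ q) (ν q) (i q) := by
    intro g
    rw [← Finset.mul_prod_erase _ _ (Finset.mem_univ r)]
    congr 1
    · simp
    · refine Finset.prod_congr rfl fun q hq => ?_
      simp [Finset.ne_of_mem_erase hq]
  have hc : ∀ M k : ℕ, (M.choose (k + 1) : F) * (k + 1) = M.choose k * ((M - k : ℕ) : F) := by
    intro M k
    exact_mod_cast Nat.choose_succ_right_eq M k
  have hm : ((m + ∑ q, i q).factorial : F) ≠ 0 := by exact_mod_cast Nat.factorial_ne_zero _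
  have hm' : (m + ∑ q, (i q : F) + 1 : F) ≠ 0 := by
    exact_mod_cast Nat.succ_ne_zero (m + ∑ q, i q)
  have hμ := hc (μ r) (i r)
  have hν := hc (ν r) (i r)
  rw [fcoeff_eq, fcoeff_eq, hs,
    hp fun M N k => (k.factorial * (M.choose k : F) * (N.choose k : F)),
    ← Finset.mul_prod_erase _ _ (Finset.mem_univ r), ← add_assoc, Nat.factorial_succ,
    Nat.factorial_succ, pow_succ]
  push_cast
  field_simp
  set P := ∏ q ∈ Finset.univ.erase r,
    ((i q).factorial * ((μ q).choose (i q) : F) * ((ν q).choose (i q) : F))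
  linear_combination (-m.factorial * (i r).factorial * P * (μ r).choose (i r + 1) * (i r + 1 : F)) *
    hν - (m.factorial * (i r).factorial * P * (ν r).choose (i r) * ((ν r - i r : ℕ) : F)) * hμ

theorem dx_dy_monomial (k : Fin n) (s : Fin n ⊕ Fin n →₀ ℕ) (c : F) :
    dx k (dy k (monomial s c)) =
      monomial (s - Finsupp.single (.inr k) 1 - Finsupp.single (.inl k) 1)
        (c * s (.inr k) * s (.inl k)) := by
  rw [pderiv_monomial, pderiv_monomial]
  simp

theorem expo_add_single (hn : 2 ≤ n) (a b : ℕ) (μ ν i : Rest n → ℕ) (r : Rest n) :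
    expo a b μ ν (i + Pi.single r 1) - Finsupp.single (.inr (fst hn)) 1 -
      Finsupp.single (.inl (fst hn)) 1 =
    expo a b μ ν i - Finsupp.single (.inr r.1) 1 - Finsupp.single (.inl r.1) 1 := by
  classical
  have hs : ∑ q, (i + Pi.single r 1 : Rest n → ℕ) q = ∑ q, i q + 1 := by
    simp [Finset.sum_add_distrib]
  have hr := rest_ne_fst (hn := hn)
  refine expo_ext hn ?_ ?_ (fun q => ?_) (fun q => ?_)
  · simp only [Finsupp.tsub_apply, expo_inl_fst, hs]
    simp [hr r, ← add_assoc]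
  · simp only [Finsupp.tsub_apply, expo_inr_fst, hs]
    simp [hr r, ← add_assoc]
  · by_cases hqr : q = r
    · subst hqr; simp [hr q, Nat.sub_sub]
    · simp [hr q, hqr, Subtype.coe_inj]
  · by_cases hqr : q = r
    · subst hqr; simp [hr q, Nat.sub_sub]
    · simp [hr q, hqr, Subtype.coe_inj]

/-- Applying ∂_{x_1}∂_{y_1} to the term of i gives the factor (a+|i|)(b+|i|), equal to (a+b+|i|)|i|
as ab = 0. Splitting |i| = ∑ i_r, the r-th share of the term i + e_r cancels ∂_{x_r}∂_{y_r} of the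
term i. -/
theorem Delta_fam [CharZero F] (hn : 2 ≤ n) {a b : ℕ} (hab : a = 0 ∨ b = 0) (μ ν : Rest n → ℕ) :
    Delta n F (fam F a b μ ν) = 0 := by
  classical
  have h1 : ∀ i : Rest n → ℕ, dx (fst hn) (dy (fst hn)
      (monomial (expo a b μ ν i) (fcoeff F (a + b) μ ν i))) =
      ∑ r, monomial (expo a b μ ν i - Finsupp.single (.inr (fst hn)) 1 -
        Finsupp.single (.inl (fst hn)) 1)
        (fcoeff F (a + b) μ ν i * ((a + b : ℕ) + (∑ q, i q : ℕ)) * i r) := by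
    intro i
    rw [dx_dy_monomial, ← map_sum, ← Finset.mul_sum, expo_inl_fst, expo_inr_fst]
    congr 1
    rcases hab with rfl | rfl <;> push_cast <;> ring
  rw [Delta_apply, sum_eq_fst_add hn, fam]
  simp only [map_sum]
  rw [Finset.sum_congr rfl fun i _ => h1 i, Finset.sum_comm, ← Finset.sum_add_distrib]
  refine Finset.sum_eq_zero fun r _ => ?_
  rw [add_comm, add_eq_zero_iff_eq_neg, ← Finset.sum_neg_distrib]
  simp only [dx_dy_monomial, expo_inl_rest, expo_inr_rest]
  have hval : ∀ i : Rest n → ℕ,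
      monomial (expo a b μ ν i - Finsupp.single (.inr r.1) 1 - Finsupp.single (.inl r.1) 1)
        (fcoeff F (a + b) μ ν i * ((ν r - i r : ℕ) : F) * ((μ r - i r : ℕ) : F)) =
      -monomial (expo a b μ ν (i + Pi.single r 1) - Finsupp.single (.inr (fst hn)) 1 -
        Finsupp.single (.inl (fst hn)) 1) (fcoeff F (a + b) μ ν (i + Pi.single r 1) *
          ((a + b : ℕ) + (∑ q, (i + Pi.single r 1 : Rest n → ℕ) q : ℕ)) *
          ((i + Pi.single r 1 : Rest n → ℕ) r : ℕ)) := by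
    intro i
    have h := fcoeff_add_single (F := F) (a + b) μ ν i r
    have hs : ∑ q, (i + Pi.single r 1 : Rest n → ℕ) q = ∑ q, i q + 1 := by
      simp [Finset.sum_add_distrib]
    rw [expo_add_single, ← map_neg, hs]
    congr 1
    simp only [Pi.add_apply, Pi.single_eq_same]
    push_cast at h ⊢
    linear_combination h
  -- The shift matches only nonzero terms: the factors μ_r - i_r and ν_r - i_r keep i + e_r in
  -- range, and the factor j_r allows e_r to be subtracted from j.
  refine Finset.sum_bij_ne_zero (fun i _ _ => i + Pi.single r 1) ?_ ?_ ?_ ?_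
  · intro i hi h
    rw [Finset.mem_Iic] at hi ⊢
    intro q
    have hq := hi q
    rw [Ne, monomial_eq_zero, mul_eq_zero, mul_eq_zero, Nat.cast_eq_zero, Nat.cast_eq_zero] at h
    by_cases hqr : q = r
    · subst hqr
      simp only [Pi.add_apply, Pi.single_eq_same, Pi.inf_apply, le_inf_iff] at hq ⊢
      omega
    · simpa [hqr] using hq
  · intro i _ _ j _ _ h
    exact add_right_cancel h
  · intro j hj h
    have hjr : j r ≠ 0 := by
      intro h0
      simp [h0] at h
    have hj' : j - Pi.single r 1 + Pi.single r 1 = j := by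
      refine tsub_add_cancel_of_le fun q => ?_
      by_cases hqr : q = r
      · subst hqr; simpa using Nat.one_le_iff_ne_zero.2 hjr
      · simp [hqr]
    refine ⟨j - Pi.single r 1, ?_, ?_, hj'⟩
    · exact Finset.mem_Iic.2 (le_trans (fun q => Nat.sub_le _ _) (Finset.mem_Iic.1 hj))
    · rw [hval, hj']
      exact h
  · exact fun i _ _ => hval i

theorem fam_mem_harmonic [CharZero F] (hn : 2 ≤ n) {a b : ℕ} (hab : a = 0 ∨ b = 0)
    (μ ν : Rest n → ℕ) :
    fam F a b μ ν ∈ harmonic n F (a + ∑ r, μ r) (b + ∑ r, ν r) :=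
  ⟨fam_mem_bihomogeneous hn a b μ ν, Delta_fam hn hab μ ν⟩

/-- The exponents of bidegree `(l₁,l₂)` which do not involve `x₁ y₁`. -/
def leading (hn : 2 ≤ n) (l₁ l₂ : ℕ) : Set (Fin n ⊕ Fin n →₀ ℕ) :=
  {s | (∑ k, s (.inl k) = l₁ ∧ ∑ k, s (.inr k) = l₂) ∧
    (s (.inl (fst hn)) = 0 ∨ s (.inr (fst hn)) = 0)}

/-- The member of the two families with a given leading exponent. -/
noncomputable def famOf (hn : 2 ≤ n) (F : Type*) [Field F] (s : Fin n ⊕ Fin n →₀ ℕ) : Poly n F :=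
  fam F (s (.inl (fst hn))) (s (.inr (fst hn))) (fun r => s (.inl r.1)) (fun r => s (.inr r.1))

theorem coeff_famOf (hn : 2 ≤ n) (s : Fin n ⊕ Fin n →₀ ℕ) {t : Fin n ⊕ Fin n →₀ ℕ}
    (ht : t (.inl (fst hn)) = 0 ∨ t (.inr (fst hn)) = 0) :
    coeff t (famOf hn F s) = if s = t then 1 else 0 := by
  rw [famOf, coeff_fam hn _ _ ht]
  congr 2
  exact expo_ext hn (by simp) (by simp) (by simp) (by simp)

theorem famOf_expo (hn : 2 ≤ n) (a b : ℕ) (μ ν : Rest n → ℕ) :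
    famOf hn F (expo a b μ ν 0) = fam F a b μ ν := by
  simp [famOf]

theorem expo_zero_mem_leading (hn : 2 ≤ n) {a b : ℕ} (hab : a = 0 ∨ b = 0) (μ ν : Rest n → ℕ) :
    expo a b μ ν 0 ∈ leading hn (a + ∑ r, μ r) (b + ∑ r, ν r) := by
  rw [leading, Set.mem_ofPred_eq, sum_eq_fst_add hn, sum_eq_fst_add hn]
  simpa using hab

theorem basisSet_eq_image (hn : 2 ≤ n) (l₁ l₂ : ℕ) :
    basisSet hn F l₁ l₂ = famOf hn F '' leading hn l₁ l₂ := by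
  ext f
  constructor
  · rintro (⟨m, μ, ν, rfl, rfl, rfl⟩ | ⟨m, μ, ν, rfl, rfl, rfl⟩)
    · refine ⟨expo m 0 μ ν 0, ?_, ?_⟩
      · simpa using expo_zero_mem_leading hn (.inr rfl) μ ν
      · rw [famOf_expo, basisFst_eq_fam]
    · refine ⟨expo 0 m μ ν 0, ?_, ?_⟩
      · simpa using expo_zero_mem_leading hn (.inl rfl) μ ν
      · rw [famOf_expo, basisSnd_eq_fam]
  · rintro ⟨s, ⟨⟨h1, h2⟩, h0 | h0⟩, rfl⟩ <;> rw [sum_eq_fst_add hn] at h1 h2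
    · refine .inr ⟨s (.inr (fst hn)), fun r => s (.inl r.1), _, ?_, h2, ?_⟩
      · rw [← h1, h0, zero_add]
      · rw [basisSnd_eq_fam, famOf, h0]
    · refine .inl ⟨s (.inl (fst hn)), _, fun r => s (.inr r.1), h1, ?_, ?_⟩
      · rw [← h2, h0, zero_add]
      · rw [basisFst_eq_fam, famOf, h0]

theorem linearIndepOn_basisSet (hn : 2 ≤ n) (l₁ l₂ : ℕ) :
    LinearIndepOn F id (basisSet hn F l₁ l₂) := by
  classical
  rw [basisSet_eq_image]
  refine LinearIndepOn.id_image ?_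
  -- Reading off the coefficients at the leading exponents turns the family into unit vectors.
  refine LinearIndependent.of_comp
    (LinearMap.pi fun t : leading hn l₁ l₂ => lcoeff F t.1) ?_
  have h : LinearMap.pi (fun t : leading hn l₁ l₂ => lcoeff F t.1) ∘
      (fun s : leading hn l₁ l₂ => famOf hn F s.1) = fun s => Pi.single s 1 := by
    ext s t
    simp [coeff_famOf hn s.1 t.2.2, Pi.single_apply, Subtype.ext_iff, eq_comm]
  rw [h]
  exact Pi.linearIndependent_single_one (leading hn l₁ l₂) F

theorem span_basisSet [CharZero F] (hn : 2 ≤ n) (l₁ l₂ : ℕ) :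
    Submodule.span F (basisSet hn F l₁ l₂) = harmonic n F l₁ l₂ := by
  classical
  rw [basisSet_eq_image]
  apply le_antisymm
  · rw [Submodule.span_le]
    rintro _ ⟨s, ⟨⟨rfl, rfl⟩, h0⟩, rfl⟩
    rw [sum_eq_fst_add hn, sum_eq_fst_add hn]
    exact fam_mem_harmonic hn h0 _ _
  · intro f hf
    -- By duality g has the same coefficients as f at the leading exponents, so rigidity forces f =
    -- g.
    set g : Poly n F := ∑ s ∈ f.support with s ∈ leading hn l₁ l₂, coeff s f • famOf hn F s with hg
    have hmem : g ∈ Submodule.span F (famOf hn F '' leading hn l₁ l₂) :=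
      Submodule.sum_mem _ fun s hs => Submodule.smul_mem _ _ <| Submodule.subset_span
        ⟨s, (Finset.mem_filter.1 hs).2, rfl⟩
    suffices f - g = 0 by rwa [sub_eq_zero.1 this]
    have hfD : Delta n F f = 0 := hf.2
    refine eq_zero_of_Delta_eq_zero (fst hn) ?_ fun t ht => ?_
    · rw [map_sub, hfD, hg, map_sum, zero_sub, neg_eq_zero]
      refine Finset.sum_eq_zero fun s hs => ?_
      rw [map_smul, famOf, Delta_fam hn (Finset.mem_filter.1 hs).2.2, smul_zero]
    · rw [coeff_sub, hg, coeff_sum, sub_eq_zero]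
      simp only [coeff_smul, coeff_famOf hn _ ht, smul_eq_mul, mul_ite, mul_one, mul_zero]
      rw [Finset.sum_ite_eq', eq_comm, ite_eq_left_iff]
      intro h
      by_contra hne
      exact h (Finset.mem_filter.2 ⟨mem_support_iff.2 (Ne.symm hne),
        mem_bihomogeneous_iff.1 hf.1 t (Ne.symm hne), ht⟩)

/-! ### Orthogonality, V = 𝓗 and irreducibility -/

theorem apolar_act (A : Matrix (Fin n) (Fin n) F) (f g : Poly n F) :
    apolar (act A f) g = apolar f (act A.transpose g) := by
  rw [act_eq_sum, act_eq_sum, Finset.sum_comm]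
  simp only [map_sum, map_smul, LinearMap.sum_apply, LinearMap.smul_apply, apolar_opE,
    Matrix.transpose_apply]

theorem gen_ne_zero (hn : 2 ≤ n) (l₁ l₂ : ℕ) : gen hn F l₁ l₂ ≠ 0 := by
  rw [gen_eq_monomial, Ne, monomial_eq_zero]
  exact one_ne_zero

theorem apolar_gen_gen_ne_zero [CharZero F] (hn : 2 ≤ n) (l₁ l₂ : ℕ) :
    apolar (gen hn F l₁ l₂) (gen hn F l₁ l₂) ≠ 0 := by
  classical
  rw [gen_eq_monomial, apolar_monomial, coeff_monomial, if_pos rfl, one_mul, mul_one]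
  exact Finset.prod_ne_zero_iff.2 fun i _ => by exact_mod_cast Nat.factorial_ne_zero _

theorem gen_mem_V (hn : 2 ≤ n) (l₁ l₂ : ℕ) : gen hn F l₁ l₂ ∈ V hn F l₁ l₂ :=
  LieSubmodule.subset_lieSpan rfl

theorem V_le_harmonicLie (hn : 2 ≤ n) (l₁ l₂ : ℕ) : V hn F l₁ l₂ ≤ harmonicLie n F l₁ l₂ :=
  LieSubmodule.lieSpan_le.2 (Set.singleton_subset_iff.2 (gen_mem_harmonic hn l₁ l₂))

/-- Every nonzero submodule of the harmonic polynomials contains `V_{ℓ₁,ℓ₂}`. -/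
theorem V_le_of_ne_bot [CharZero F] (hn : 2 ≤ n) {l₁ l₂ : ℕ}
    {N : LieSubmodule F (sl (Fin n) F) (Poly n F)} (hN : N ≤ harmonicLie n F l₁ l₂)
    (hbot : N ≠ ⊥) : V hn F l₁ l₂ ≤ N := by
  refine LieSubmodule.lieSpan_le.2 (Set.singleton_subset_iff.2 ?_)
  refine gen_mem_of_ne_bot hn (N := N.toSubmodule) hN (fun i j hij f hf => ?_) (by simpa using hbot)
  have := N.lie_mem (x := single i j hij.ne (1 : F)) hf
  rwa [lie_single] at this

/-- The transpose of a traceless matrix. -/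
def slTranspose (A : sl (Fin n) F) : sl (Fin n) F :=
  ⟨A.1.transpose, by
    have := A.2
    simp only [sl, ← LieSubalgebra.mem_toSubmodule, LinearMap.mem_ker] at this ⊢
    simpa using this⟩

/-- The harmonic polynomials orthogonal to `V_{ℓ₁,ℓ₂}`. -/
noncomputable def orth (hn : 2 ≤ n) (F : Type*) [Field F] (l₁ l₂ : ℕ) :
    LieSubmodule F (sl (Fin n) F) (Poly n F) where
  __ := harmonic n F l₁ l₂ ⊓ ⨅ v ∈ V hn F l₁ l₂, LinearMap.ker (apolar.flip v)
  lie_mem {A f} hf := by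
    refine ⟨(harmonicLie n F l₁ l₂).lie_mem hf.1, ?_⟩
    have h2 := hf.2
    simp only [SetLike.mem_coe, Submodule.mem_iInf, LinearMap.mem_ker, LinearMap.flip_apply]
      at h2 ⊢
    intro v hv
    rw [lie_def, apolar_act]
    exact h2 _ ((V hn F l₁ l₂).lie_mem (x := slTranspose A) hv)

theorem mem_orth {hn : 2 ≤ n} {l₁ l₂ : ℕ} {f : Poly n F} :
    f ∈ orth hn F l₁ l₂ ↔ f ∈ harmonic n F l₁ l₂ ∧ ∀ v ∈ V hn F l₁ l₂, apolar f v = 0 := by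
  change f ∈ harmonic n F l₁ l₂ ⊓ ⨅ v ∈ V hn F l₁ l₂, LinearMap.ker (apolar.flip v) ↔ _
  simp [Submodule.mem_iInf]

/-- Otherwise the generator would be orthogonal to itself. -/
theorem orth_eq_bot [CharZero F] (hn : 2 ≤ n) (l₁ l₂ : ℕ) : orth hn F l₁ l₂ = ⊥ := by
  by_contra h
  have := V_le_of_ne_bot hn (fun f hf => (mem_orth.1 hf).1) h (gen_mem_V hn l₁ l₂)
  exact apolar_gen_gen_ne_zero hn l₁ l₂ ((mem_orth.1 this).2 _ (gen_mem_V hn l₁ l₂))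

instance finite_harmonic (l₁ l₂ : ℕ) : Module.Finite F (harmonic n F l₁ l₂) := by
  refine Submodule.finiteDimensional_of_le (S₂ := restrictTotalDegree _ F (l₁ + l₂)) ?_
  intro f hf
  rw [mem_restrictTotalDegree, totalDegree]
  refine Finset.sup_le fun s hs => ?_
  obtain ⟨rfl, rfl⟩ := mem_bihomogeneous_iff.1 hf.1 s (mem_support_iff.1 hs)
  rw [Finsupp.sum_fintype _ _ (fun _ => rfl), Fintype.sum_sum_type]

theorem V_eq_harmonic [CharZero F] (hn : 2 ≤ n) (l₁ l₂ : ℕ) :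
    (V hn F l₁ l₂).toSubmodule = harmonic n F l₁ l₂ := by
  have hle : (V hn F l₁ l₂).toSubmodule ≤ harmonic n F l₁ l₂ := V_le_harmonicLie hn l₁ l₂
  have : Module.Finite F (V hn F l₁ l₂).toSubmodule := Submodule.finiteDimensional_of_le hle
  refine Submodule.eq_of_le_of_finrank_le hle ?_
  rw [← Subspace.dual_finrank_eq (V := (V hn F l₁ l₂).toSubmodule)]
  -- The pairing sends harmonic polynomials to the dual of V, with kernel the orthogonal complement,
  -- which is zero.
  refine LinearMap.finrank_le_finrank_of_injective
    (f := (apolar.domRestrict₁₂ (harmonic n F l₁ l₂) (V hn F l₁ l₂).toSubmodule)) ?_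
  rw [← LinearMap.ker_eq_bot, LinearMap.ker_eq_bot']
  intro f hf
  have : f.1 ∈ orth hn F l₁ l₂ := mem_orth.2 ⟨f.2, fun v hv => LinearMap.congr_fun hf ⟨v, hv⟩⟩
  rw [orth_eq_bot] at this
  exact Subtype.ext this

theorem isIrreducible_V [CharZero F] (hn : 2 ≤ n) (l₁ l₂ : ℕ) :
    LieModule.IsIrreducible F (sl (Fin n) F) (V hn F l₁ l₂) := by
  have : Nontrivial (V hn F l₁ l₂) :=
    ⟨⟨⟨_, gen_mem_V hn l₁ l₂⟩, 0, fun h => gen_ne_zero hn l₁ l₂ (congrArg Subtype.val h)⟩⟩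
  refine LieModule.IsIrreducible.mk fun N hN => ?_
  have h1 : N.map (V hn F l₁ l₂).incl ≤ V hn F l₁ l₂ := LieSubmodule.map_incl_le
  have h2 : N.map (V hn F l₁ l₂).incl ≠ ⊥ := by
    obtain ⟨v, hv, hv0⟩ := N.toSubmodule.ne_bot_iff.1 (by simpa using hN)
    intro h
    have : v.1 ∈ N.map (V hn F l₁ l₂).incl := LieSubmodule.mem_map_of_mem hv
    rw [h] at this
    exact hv0 (Subtype.ext this)
  have h3 := V_le_of_ne_bot hn (h1.trans (V_le_harmonicLie hn l₁ l₂)) h2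
  rw [eq_top_iff]
  intro v _
  obtain ⟨w, hw, hwv⟩ := (LieSubmodule.mem_map _).1 (h3 v.2)
  obtain rfl : w = v := Subtype.ext hwv
  exact hw

/-! ### The highest weight -/

theorem cartan_isDiag (h : sl (Fin n) F) (hh : h ∈ cartan n F) (i j : Fin n) (hij : i ≠ j) :
    h.1 i j = 0 := by
  induction hh using Submodule.span_induction with
  | mem h hh =>
    obtain ⟨k, l, -, rfl⟩ := hh
    rw [val_singleSubSingle, Matrix.sub_apply, Matrix.single_apply, Matrix.single_apply]
    rw [if_neg (by rintro ⟨rfl, rfl⟩; exact hij rfl), if_neg (by rintro ⟨rfl, rfl⟩; exact hij rfl),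
      sub_zero]
  | zero => rfl
  | add a b _ _ ha hb =>
    change a.1 i j + b.1 i j = 0
    rw [ha, hb, add_zero]
  | smul c a _ ha =>
    change c * a.1 i j = 0
    rw [ha, mul_zero]

theorem act_gen_of_diag (hn : 2 ≤ n) (l₁ l₂ : ℕ) (A : Matrix (Fin n) (Fin n) F)
    (hA : ∀ i j, i ≠ j → A i j = 0) :
    act A (gen hn F l₁ l₂) =
      (l₁ * A (fst hn) (fst hn) - l₂ * A (lst hn) (lst hn)) • gen hn F l₁ l₂ := by
  have hx : act A (x (fst hn)) = A (fst hn) (fst hn) • x (fst hn) := by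
    rw [act_x]
    exact Finset.sum_eq_single _ (fun i _ hi => by rw [hA _ _ hi, zero_smul]) (by simp)
  have hy : act A (y (lst hn)) = -(A (lst hn) (lst hn) • y (lst hn)) := by
    rw [act_y]
    congr 1
    exact Finset.sum_eq_single _ (fun i _ hi => by rw [hA _ _ hi.symm, zero_smul]) (by simp)
  rw [gen, Derivation.leibniz, Derivation.leibniz_pow, Derivation.leibniz_pow, hx, hy]
  simp only [smul_eq_mul, MvPolynomial.smul_eq_C_mul, nsmul_eq_mul, map_sub, map_mul, map_natCast]
  -- The Leibniz rule for powers produces truncated exponents l - 1, hence the separate treatment of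
  -- zero.
  rcases l₁ with _ | l₁ <;> rcases l₂ with _ | l₂ <;> simp [pow_succ] <;> ring

theorem isSingularVector_gen (hn : 2 ≤ n) (l₁ l₂ : ℕ) :
    IsSingularVector (l₁ • fundamentalWeight n F 1 + l₂ • fundamentalWeight n F (n - 1))
      (gen hn F l₁ l₂) where
  ne_zero := gen_ne_zero hn l₁ l₂
  lie_pos i j hij := by
    have hj : j ≠ fst hn := by
      rintro rfl
      exact absurd (Fin.lt_def.1 hij) (by simp [fst])
    have hi : i ≠ lst hn := by
      rintro rfl
      exact absurd (Fin.lt_def.1 hij) (by have := j.2; simp [lst]; omega)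
    rw [lie_single, gen_eq_monomial, pderiv_monomial, pderiv_monomial]
    simp [hi, hj]
  lie_cartan h := by
    have hw1 : fundamentalWeight n F 1 h = h.1.1 (fst hn) (fst hn) := by
      change (∑ j : Fin n, if (j : ℕ) < 1 then (h.1.1 j j : F) else 0) = _
      rw [Finset.sum_eq_single (fst hn)]
      · simp [fst]
      · intro j _ hj
        rw [if_neg]
        have := fst_lt hj
        simpa [fst, Fin.lt_def, Nat.pos_iff_ne_zero] using this
      · simp
    have htr : ∑ j : Fin n, h.1.1 j j = 0 := by
      have := h.1.2
      simp only [sl, ← LieSubalgebra.mem_toSubmodule, LinearMap.mem_ker] at this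
      exact this
    have hw2 : fundamentalWeight n F (n - 1) h = -h.1.1 (lst hn) (lst hn) := by
      change (∑ j : Fin n, if (j : ℕ) < n - 1 then (h.1.1 j j : F) else 0) = _
      -- The first n - 1 diagonal entries and the last one add up to the trace, which is zero.
      refine eq_neg_of_add_eq_zero_left (Eq.trans ?_ htr)
      have hl : ¬ ((lst hn : Fin n) : ℕ) < n - 1 := by simp [lst]
      rw [← Finset.sum_erase_add _ _ (Finset.mem_univ (lst hn)),
        ← Finset.sum_erase_add _ (fun j => h.1.1 j j) (Finset.mem_univ (lst hn)), if_neg hl,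
        add_zero]
      congr 1
      exact Finset.sum_congr rfl fun j hj => if_pos (lt_lst (Finset.ne_of_mem_erase hj))
    rw [lie_def, act_gen_of_diag hn l₁ l₂ _ (cartan_isDiag _ h.2), LinearMap.add_apply,
      LinearMap.smul_apply, LinearMap.smul_apply, hw1, hw2, nsmul_eq_mul, nsmul_eq_mul, mul_neg,
      sub_eq_add_neg]

theorem isHighestWeightModule_V [CharZero F] (hn : 2 ≤ n) (l₁ l₂ : ℕ) :
    IsHighestWeightModule (V hn F l₁ l₂)
      (l₁ • fundamentalWeight n F 1 + l₂ • fundamentalWeight n F (n - 1)) := by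
  have hs := isSingularVector_gen (F := F) hn l₁ l₂
  have := isIrreducible_V (F := F) hn l₁ l₂
  refine ⟨⟨gen hn F l₁ l₂, gen_mem_V hn l₁ l₂⟩, ⟨?_, ?_, ?_⟩, ?_⟩
  · exact fun h => hs.ne_zero (congrArg Subtype.val h)
  · exact fun i j hij => Subtype.ext (hs.lie_pos i j hij)
  · exact fun h => Subtype.ext (hs.lie_cartan h)
  · refine (IsSimpleOrder.eq_bot_or_eq_top _).resolve_left fun h => ?_
    rw [LieSubmodule.lieSpan_eq_bot_iff] at h
    exact hs.ne_zero (congrArg Subtype.val (h _ rfl))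

end SlPoly

theorem theorem4p3 (F : Type*) [Field F] [CharZero F] (n : ℕ) (hn : 2 ≤ n) (l₁ l₂ : ℕ) :
    LieModule.IsIrreducible F (LieAlgebra.SpecialLinear.sl (Fin n) F) (SlPoly.V hn F l₁ l₂) ∧
    SlPoly.IsSingularVector
      (l₁ • SlPoly.fundamentalWeight n F 1 + l₂ • SlPoly.fundamentalWeight n F (n - 1))
      (SlPoly.gen hn F l₁ l₂) ∧
    SlPoly.IsHighestWeightModule (SlPoly.V hn F l₁ l₂)
      (l₁ • SlPoly.fundamentalWeight n F 1 + l₂ • SlPoly.fundamentalWeight n F (n - 1)) ∧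
    (SlPoly.V hn F l₁ l₂).toSubmodule = SlPoly.harmonic n F l₁ l₂ ∧
    LinearIndepOn F id (SlPoly.basisSet hn F l₁ l₂) ∧
    Submodule.span F (SlPoly.basisSet hn F l₁ l₂) = (SlPoly.V hn F l₁ l₂).toSubmodule :=
  ⟨SlPoly.isIrreducible_V hn l₁ l₂, SlPoly.isSingularVector_gen hn l₁ l₂,
    SlPoly.isHighestWeightModule_V hn l₁ l₂, SlPoly.V_eq_harmonic hn l₁ l₂,
    SlPoly.linearIndepOn_basisSet hn l₁ l₂,
    (SlPoly.span_basisSet hn l₁ l₂).trans (SlPoly.V_eq_harmonic hn l₁ l₂).symm⟩
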